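/- All topological spaces are compactly generated, i.e. weak Hausdorff $k$-spaces, and products and fibre products are taken in that category. A \emph{flow} $X$ consists of a set (discrete space) $X^0$ of states, a space $\mathbb{P}X$ of paths, continuous maps $s,t:\mathbb{P}X\to X^0$, and a continuous associative composition $*:\{(x,y)\in\mathbb{P}X\times\mathbb{P}X : t(x)=s(y)\}\to\mathbb{P}X$ with $s(x*y)=s(x)$ and $t(x*y)=t(y)$. A \emph{morphism} $f:X\to Y$ of flows consists of a map $f^0:X^0\to Y^0$ and a continuous map $\mathbb{P}f:\mathbb{P}X\to\mathbb{P}Y$ compatible with $s$, $t$ and $*$; it is \emph{synchronized} if $f^0$ is bijective. An \emph{S-homotopy} $H$ from $X$ to $Y$ is a family $(H_u)_{u\in[0,1]}$ of morphisms of flows $X\to Y$ such that $(u,x)\mapsto H_u(x)$ is continuous on $[0,1]\times(X^0\sqcup\mathbb{P}X)$. A morphism $i:A\to X$ has the \emph{S-homotopy extension property} if it is synchronized and if, for every flow $Y$, every morphism $f:X\to Y$ and every S-homotopy $h$ from $A$ to $Y$ with $h_0=f\circ i$, there is an S-homotopy $H$ from $X$ to $Y$ with $H_0=f$ and $H_u\circ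 i=h_u$ for all $u\in[0,1]$. For a space $Z$, let $\mathrm{Glob}(Z)$ be the flow with states $\{0,1\}$ and path space $Z$, with $s=0$ and $t=1$. A \emph{cofibration} of flows is a morphism that has the left lifting property with respect to every morphism having the right lifting property with respect to the morphisms $\mathrm{Glob}(\mathbf{S}^{n-1})\to\mathrm{Glob}(\mathbf{D}^n)$ ($n\ge 0$, $\mathbf{S}^{-1}=\varnothing$) induced by the inclusions, $R:\{0,1\}\to\{0\}$ and $C:\varnothing\to\{0\}$ (the last two between flows without paths); these are the cofibrations of the model structure on flows whose weak equivalences are the synchronized morphisms inducing a weak homotopy equivalence of path spaces. \textbf{Theorem.} (1) If a morphism of flows $i:A\to X$ has the S-homotopy extension property, then $\mathbb{P}i:\mathbb{P}A\to\mathbb{P}X$ is a closed inclusion of topological spaces (a homeomorphism onto a closed subspace). (2) If $i:A\to X$ is a cofibration of flows, then $\mathbb{P}i:\mathbb{P}A\to\mathbb{P}X$ is a closed inclusion of topological spaces. -/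

import Mathlib

open CategoryTheory Topology

universe u

/-- A topological space is weak Hausdorff if every continuous image of a compact Hausdorff space
in it is closed. -/
class WeakHausdorffSpace (X : Type u) [TopologicalSpace X] : Prop where
  isClosed_range : ∀ (K : Type u) [TopologicalSpace K] [CompactSpace K] [T2Space K] (f : K → X),
    Continuous f → IsClosed (Set.range f)

instance WeakHausdorffSpace.of_t2 (X : Type u) [TopologicalSpace X] [T2Space X] :
    WeakHausdorffSpace X where
  isClosed_range _ _ _ _ _ hf := (isCompact_range hf).isClosed

/-- A flow: a set of states (viewed as a discrete space), a compactly generated (that is, weak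
Hausdorff `k`-) space of non-constant execution paths, continuous source and target maps, and a
continuous associative composition law on composable pairs of paths.

The space of composable pairs is the fibre product in the category of compactly generated spaces:
the `k`-ification of the subspace topology inherited from the product topology. -/
structure PathFlow where
  State : Type u
  Path : Type u
  [topPath : TopologicalSpace Path]
  [compactlyGeneratedPath : CompactlyGeneratedSpace Path]
  [weakHausdorffPath : WeakHausdorffSpace Path]
  src : Path → State
  tgt : Path → State
  continuous_src : Continuous[topPath, ⊥] src
  continuous_tgt : Continuous[topPath, ⊥] tgt
  comp : (x y : Path) → tgt x = src y → Path
  continuous_comp :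
    Continuous[TopologicalSpace.compactlyGenerated.{u} {p : Path × Path // tgt p.1 = src p.2},
      topPath] (fun p => comp p.1.1 p.1.2 p.2)
  src_comp : ∀ (x y : Path) (h : tgt x = src y), src (comp x y h) = src x
  tgt_comp : ∀ (x y : Path) (h : tgt x = src y), tgt (comp x y h) = tgt y
  comp_assoc : ∀ (x y z : Path) (hxy : tgt x = src y) (hyz : tgt y = src z),
    comp (comp x y hxy) z ((tgt_comp x y hxy).trans hyz) =
      comp x (comp y z hyz) (hxy.trans (src_comp y z hyz).symm)

namespace PathFlow

attribute [instance] topPath compactlyGeneratedPath weakHausdorffPath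

/-- A morphism of flows. -/
@[ext]
structure Hom (X Y : PathFlow.{u}) where
  onState : X.State → Y.State
  onPath : X.Path → Y.Path
  continuous_onPath : Continuous onPath
  map_src : ∀ x, onState (X.src x) = Y.src (onPath x)
  map_tgt : ∀ x, onState (X.tgt x) = Y.tgt (onPath x)
  map_comp : ∀ (x y : X.Path) (h : X.tgt x = X.src y),
    onPath (X.comp x y h) = Y.comp (onPath x) (onPath y)
      ((map_tgt x).symm.trans ((congrArg onState h).trans (map_src y)))

/-- The category of flows. -/
instance : Category PathFlow.{u} where
  Hom := Hom
  id X := ⟨id, id, continuous_id, fun _ => rfl, fun _ => rfl, fun _ _ _ => rfl⟩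
  comp f g :=
    { onState := g.onState ∘ f.onState
      onPath := g.onPath ∘ f.onPath
      continuous_onPath := g.continuous_onPath.comp f.continuous_onPath
      map_src := fun x => (congrArg g.onState (f.map_src x)).trans (g.map_src _)
      map_tgt := fun x => (congrArg g.onState (f.map_tgt x)).trans (g.map_tgt _)
      map_comp := fun x y h => (congrArg g.onPath (f.map_comp x y h)).trans (g.map_comp _ _ _) }

/-- A morphism of flows is synchronized if it is bijective on states. -/
def Synchronized {X Y : PathFlow.{u}} (f : X ⟶ Y) : Prop :=
  Function.Bijective f.onState

/-- An S-homotopy between morphisms of flows from `X` to `Y`: a family `H u`, `u ∈ [0,1]`, of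
morphisms of flows such that `(u, x) ↦ H u x` is continuous on `[0,1] × X`, where the underlying
space of `X` is the disjoint sum of the discrete space of states and of the path space.
(As `[0,1]` is compact Hausdorff, `[0,1] × X.Path` with the product topology is already a
`k`-space, so this is also the product of compactly generated spaces.) -/
structure SHomotopy (X Y : PathFlow.{u}) where
  toFun : unitInterval → (X ⟶ Y)
  continuous_onState : ∀ a : X.State, Continuous[inferInstance, ⊥] fun u => (toFun u).onState a
  continuous_onPath : Continuous fun p : unitInterval × X.Path => (toFun p.1).onPath p.2

/-- The S-homotopy extension property of a morphism `i : A ⟶ X` with respect to a flow `Y`. -/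
def HasSHEPFor {A X : PathFlow.{u}} (i : A ⟶ X) (Y : PathFlow.{u}) : Prop :=
  ∀ (f : X ⟶ Y) (h : SHomotopy A Y), h.toFun 0 = i ≫ f →
    ∃ H : SHomotopy X Y, H.toFun 0 = f ∧ ∀ t, i ≫ H.toFun t = h.toFun t

/-- A morphism of flows has the S-homotopy extension property if it is synchronized and has the
S-homotopy extension property with respect to every flow. -/
def HasSHEP {A X : PathFlow.{u}} (i : A ⟶ X) : Prop :=
  Synchronized i ∧ ∀ Y : PathFlow.{u}, HasSHEPFor i Y

/-- The class of morphisms of flows inducing a closed inclusion of path spaces. -/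
def closedInclusions : MorphismProperty PathFlow.{u} :=
  fun _ _ f => IsClosedEmbedding f.onPath

/-- The globe of a compactly generated space `Z`: two states `0` (`false`) and `1` (`true`), and
the path space `Z`, all paths going from `0` to `1`. -/
def glob (Z : Type u) [TopologicalSpace Z] [CompactlyGeneratedSpace Z] [WeakHausdorffSpace Z] :
    PathFlow.{u} where
  State := ULift.{u} Bool
  Path := Z
  src _ := ⟨false⟩
  tgt _ := ⟨true⟩
  continuous_src := @continuous_const _ _ _ ⊥ _
  continuous_tgt := @continuous_const _ _ _ ⊥ _
  comp _ _ h := absurd (congrArg ULift.down h) Bool.noConfusion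
  continuous_comp := by
    have : IsEmpty {p : Z × Z // (⟨true⟩ : ULift.{u} Bool) = ⟨false⟩} :=
      ⟨fun p => absurd (congrArg ULift.down p.2) Bool.noConfusion⟩
    exact @continuous_of_const _ _ (_) (_) _ fun p => isEmptyElim p
  src_comp _ _ _ := rfl
  tgt_comp _ _ _ := rfl
  comp_assoc _ _ _ h := absurd (congrArg ULift.down h) Bool.noConfusion

/-- The morphism of globes induced by a continuous map. -/
def globMap {Z W : Type u} [TopologicalSpace Z] [CompactlyGeneratedSpace Z] [WeakHausdorffSpace Z]
    [TopologicalSpace W] [CompactlyGeneratedSpace W] [WeakHausdorffSpace W] (f : C(Z, W)) :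
    glob Z ⟶ glob W :=
  Hom.mk id f f.continuous (fun _ => rfl) (fun _ => rfl)
    (fun _ _ h => absurd (congrArg ULift.down h) Bool.noConfusion)

/-- The flow with set of states `S` and no non-constant execution path. -/
def achronal (S : Type u) : PathFlow.{u} where
  State := S
  Path := PEmpty
  src := PEmpty.elim
  tgt := PEmpty.elim
  continuous_src := @continuous_of_const _ _ (_) (_) _ fun x => x.elim
  continuous_tgt := @continuous_of_const _ _ (_) (_) _ fun x => x.elim
  comp x := x.elim
  continuous_comp := @continuous_of_const _ _ (_) (_) _ fun p => p.1.1.elim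
  src_comp x := x.elim
  tgt_comp x := x.elim
  comp_assoc x := x.elim

/-- The morphism of flows without paths induced by a map of sets. -/
def achronalMap {S T : Type u} (f : S → T) : achronal S ⟶ achronal T :=
  Hom.mk f id continuous_id (fun x => x.elim) (fun x => x.elim) (fun x => x.elim)

instance (n : ℕ) : T2Space (TopCat.disk.{u} n) :=
  inferInstanceAs (T2Space (ULift _))

instance (n : ℕ) : T2Space (TopCat.diskBoundary.{u} n) :=
  inferInstanceAs (T2Space (ULift _))

/-- The morphisms `Glob(S^{n-1}) ⟶ Glob(D^n)`, `n ≥ 0`, induced by the inclusions. -/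
noncomputable def globSphereToDisk (n : ℕ) :
    glob (TopCat.diskBoundary.{u} n) ⟶ glob (TopCat.disk.{u} n) :=
  globMap (TopCat.diskBoundaryInclusion n).hom

/-- The morphism `R : {0,1} ⟶ {0}`. -/
def morphismR : achronal (ULift.{u} Bool) ⟶ achronal PUnit.{u + 1} :=
  achronalMap fun _ => PUnit.unit

/-- The morphism `C : ∅ ⟶ {0}`. -/
def morphismC : achronal PEmpty.{u + 1} ⟶ achronal PUnit.{u + 1} :=
  achronalMap PEmpty.elim

/-- The set of generating cofibrations: the morphisms `Glob(S^{n-1}) ⟶ Glob(D^n)` for `n ≥ 0`,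
together with `R` and `C`. -/
inductive generatingCofibrations : MorphismProperty PathFlow.{u}
  | globe (n : ℕ) : generatingCofibrations (globSphereToDisk n)
  | R : generatingCofibrations morphismR
  | C : generatingCofibrations morphismC

/-- The cofibrations of the model structure on flows: the morphisms having the left lifting
property with respect to every morphism that has the right lifting property with respect to the
generating cofibrations. -/
def cofibrations : MorphismProperty PathFlow.{u} :=
  generatingCofibrations.rlp.llp

end PathFlow

/-!
Everything is detected by one flow, the cone of `A`. It has a single state; its paths are an apex
and the pairs `(x, t)` of a path `x` of `A` and a height `t > 0`. A composite of composable paths is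
taken at the minimum of their heights, and every other composite is the apex. The inclusion of `A`
at height `t`, for `t` from `0` to `1`, is an S-homotopy from a constant morphism to a closed
inclusion.

If `i : A ⟶ X` has the S-homotopy extension property, this S-homotopy extends to `X`, since the
constant morphism does. If `i` is a cofibration, the closed inclusion at height `1` extends to `X`,
since the cone has the right lifting property over the terminal flow: a map from a sphere to the
cone extends to the disk by scaling heights. Either way a closed inclusion factors through `i`, and
a continuous map to a compactly generated weak Hausdorff space is a closed embedding as soon as it
becomes one after composition with some continuous map.
-/

section CompactlyGenerated

variable {X Y : Type u} [TopologicalSpace X] [TopologicalSpace Y]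

theorem compactlyGeneratedSpace_of_isClosedEmbedding [CompactlyGeneratedSpace Y] {e : X → Y}
    (he : IsClosedEmbedding e) : CompactlyGeneratedSpace X := by
  refine compactlyGeneratedSpace_of_isClosed fun s hs => ?_
  refine he.isClosed_iff_image_isClosed.2 ?_
  refine CompactlyGeneratedSpace.isClosed' fun K _ _ _ f hf => ?_
  have hC : IsClosed (f ⁻¹' Set.range e) := he.isClosed_range.preimage hf
  have : CompactSpace (f ⁻¹' Set.range e) := isCompact_iff_compactSpace.1 hC.isCompact
  choose g hg using fun k : f ⁻¹' Set.range e => k.2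
  have hg_cont : Continuous g := he.isInducing.continuous_iff.2 <|
    (hf.comp continuous_subtype_val).congr fun k => (hg k).symm
  convert hC.isClosedEmbedding_subtypeVal.isClosedMap _ (hs _ g hg_cont) using 1
  ext k
  constructor
  · rintro ⟨x, hx, hxk⟩
    exact ⟨⟨k, x, hxk⟩, by rwa [Set.mem_preimage, he.injective ((hg _).trans hxk.symm)], rfl⟩
  · rintro ⟨k, hk, rfl⟩
    exact ⟨g k, hk, hg k⟩

-- Maps out of `I × X` are curried: `C(I, Z)` has the right universal property as `I` is compact.
theorem compactlyGeneratedSpace_prod {I : Type} [TopologicalSpace I] [CompactSpace I] [T2Space I]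
    [CompactlyGeneratedSpace X] : CompactlyGeneratedSpace (I × X) := by
  refine compactlyGeneratedSpace_of_continuous_maps fun {Z} _ f hf => ?_
  have hf_prod (K : Type u) [TopologicalSpace K] [CompactSpace K] [T2Space K] (g : K → X)
      (hg : Continuous g) : Continuous fun p : K × I => f (p.2, g p.1) :=
    hf (K × I) (fun p => (p.2, g p.1)) (by fun_prop)
  have hf_slice (x : X) : Continuous fun t : I => f (t, x) :=
    (hf_prod PUnit (fun _ => x) continuous_const).comp (Continuous.prodMk_right PUnit.unit)
  let curried : X → C(I, Z) := fun x => ⟨_, hf_slice x⟩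
  have h_curried : Continuous curried :=
    continuous_from_compactlyGeneratedSpace curried fun K _ _ _ g hg =>
      (ContinuousMap.curry ⟨_, hf_prod K g hg⟩).continuous
  exact (ContinuousMap.continuous_uncurry_of_continuous ⟨curried, h_curried⟩).comp continuous_swap

end CompactlyGenerated

/-- The `k`-ification of a topological space `X`: the same set with the finest topology for which
the continuous maps from compact Hausdorff spaces to `X` remain continuous. A type synonym keeps the
two topologies apart. -/
def KIfication (X : Type u) : Type u := X

namespace KIfication

variable {X : Type u} [TopologicalSpace X]

instance : TopologicalSpace (KIfication X) := TopologicalSpace.compactlyGenerated.{u} X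

/-- The identity, as a bijection from a space to its `k`-ification. -/
def of : X ≃ KIfication X := Equiv.refl X

theorem continuous_of_forall_compact {Z : Type*} [TopologicalSpace Z] {f : KIfication X → Z}
    (hf : ∀ (K : Type u) [TopologicalSpace K] [CompactSpace K] [T2Space K] (g : K → X),
      Continuous g → Continuous fun k => f (of (g k))) : Continuous f :=
  continuous_from_compactlyGenerated (X := X) f fun S g => hf S g g.continuous

theorem continuous_of_symm : Continuous (of.symm : KIfication X → X) :=
  continuous_of_forall_compact fun _ _ _ _ _ hg => hg

theorem continuous_of_comp {Y : Type u} [TopologicalSpace Y] [CompactlyGeneratedSpace Y] {f : Y → X}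
    (hf : Continuous f) : Continuous fun y => of (f y) := by
  refine continuous_from_compactlyGeneratedSpace _ fun K _ _ _ g hg => ?_
  let eval : (Σ i : (S : CompHaus.{u}) × C(S, X), i.fst) → KIfication X := fun p => of (p.1.2 p.2)
  have h_eval : Continuous eval := continuous_coinduced_rng
  exact h_eval.comp
    (continuous_sigmaMk (σ := fun i : (S : CompHaus.{u}) × C(S, X) => i.fst)
      (i := ⟨CompHaus.of K, ⟨f ∘ g, hf.comp hg⟩⟩))

theorem isClosedEmbedding_of_comp {Y : Type u} [TopologicalSpace Y] [CompactlyGeneratedSpace Y]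
    {f : Y → X} (hf : IsClosedEmbedding f) : IsClosedEmbedding fun y => of (f y) :=
  ⟨.of_comp (continuous_of_comp hf.continuous) continuous_of_symm hf.isEmbedding,
    hf.isClosed_range.preimage continuous_of_symm⟩

instance : CompactlyGeneratedSpace (KIfication X) :=
  compactlyGeneratedSpace_of_continuous_maps fun _ hf =>
    continuous_of_forall_compact fun K _ _ _ _ hg => hf K _ (continuous_of_comp hg)

instance [WeakHausdorffSpace X] : WeakHausdorffSpace (KIfication X) where
  isClosed_range K _ _ _ f hf :=
    (WeakHausdorffSpace.isClosed_range K (of.symm ∘ f) (continuous_of_symm.comp hf)).preimage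
      continuous_of_symm

end KIfication

theorem t2Space_of_isClosedMap {X Y : Type*} [TopologicalSpace X] [TopologicalSpace Y]
    [NormalSpace X] [T1Space Y] {f : X → Y} (hf : Continuous f) (hcl : IsClosedMap f)
    (hsurj : Function.Surjective f) : T2Space Y := by
  refine ⟨fun y z hyz => ?_⟩
  obtain ⟨U, V, hU, hV, hyU, hzV, hUV⟩ := normal_separation (isClosed_singleton.preimage hf)
    (isClosed_singleton.preimage hf) (Disjoint.preimage f (Set.disjoint_singleton.2 hyz))
  refine ⟨Set.kernImage f U, Set.kernImage f V, isClosedMap_iff_kernImage.1 hcl hU,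
    isClosedMap_iff_kernImage.1 hcl hV, fun _ h => hyU h, fun _ h => hzV h,
    Set.disjoint_left.2 fun w hwU hwV => ?_⟩
  obtain ⟨x, rfl⟩ := hsurj w
  exact Set.disjoint_left.1 hUV (hwU rfl) (hwV rfl)

namespace WeakHausdorffSpace

variable {X : Type u} [TopologicalSpace X] [WeakHausdorffSpace X]

instance (priority := 100) t1Space : T1Space X where
  t1 x := by simpa using isClosed_range PUnit (fun _ => x) continuous_const

section CompactDomain

variable {K : Type u} [TopologicalSpace K] [CompactSpace K] [T2Space K] {f : K → X}

theorem isClosedMap (hf : Continuous f) : IsClosedMap f := fun s hs => by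
  have : CompactSpace s := isCompact_iff_compactSpace.1 hs.isCompact
  simpa [Set.range_comp] using isClosed_range s (f ∘ Subtype.val) (hf.comp continuous_subtype_val)

theorem t2Space_range (hf : Continuous f) : T2Space (Set.range f) :=
  t2Space_of_isClosedMap hf.rangeFactorization ((isClosedMap hf).codRestrict Set.mem_range_self)
    Set.rangeFactorization_surjective

theorem isClosed_range_prodMk {Y : Type*} [TopologicalSpace Y] [T2Space Y] {g : K → Y}
    (hf : Continuous f) (hg : Continuous g) : IsClosed (Set.range fun k => (f k, g k)) := by
  have := t2Space_range hf
  have h_range : IsClosed (Set.range fun k => (Set.rangeFactorization f k, g k)) :=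
    (isCompact_range (hf.rangeFactorization.prodMk hg)).isClosed
  have h_incl : IsClosedEmbedding (Prod.map Subtype.val id : Set.range f × Y → X × Y) :=
    (isClosed_range K f hf).isClosedEmbedding_subtypeVal.prodMap .id
  have h_image := h_incl.isClosedMap _ h_range
  rwa [← Set.range_comp] at h_image

end CompactDomain

theorem isClosed_eq {Y : Type u} [TopologicalSpace Y] [CompactlyGeneratedSpace Y] {f g : Y → X}
    (hf : Continuous f) (hg : Continuous g) : IsClosed {y | f y = g y} := by
  refine CompactlyGeneratedSpace.isClosed' fun K _ _ _ h hh => ?_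
  let F : K ⊕ K → X := Sum.elim (f ∘ h) (g ∘ h)
  have hF : Continuous F := (hf.comp hh).sumElim (hg.comp hh)
  have := t2Space_range hF
  have h_eq := _root_.isClosed_eq (hF.rangeFactorization.comp continuous_inl)
    (hF.rangeFactorization.comp continuous_inr)
  convert h_eq using 1
  exact Set.ext fun _ => ⟨fun hk => Subtype.ext hk, fun hk => congrArg Subtype.val hk⟩

theorem isClosedEmbedding_of_isClosedEmbedding_comp [CompactlyGeneratedSpace X] {A Y : Type*}
    [TopologicalSpace A] [TopologicalSpace Y] {e : A → X} {g : X → Y} (he : Continuous e)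
    (hg : Continuous g) (hge : IsClosedEmbedding (g ∘ e)) : IsClosedEmbedding e := by
  refine ⟨.of_comp he hg hge.isEmbedding, ?_⟩
  let S : Set X := g ⁻¹' Set.range (g ∘ e)
  have hS : IsClosedEmbedding (Subtype.val : S → X) :=
    (hge.isClosed_range.preimage hg).isClosedEmbedding_subtypeVal
  have := compactlyGeneratedSpace_of_isClosedEmbedding hS
  choose r hr using fun x : S => x.2
  have hr_cont : Continuous r := hge.isInducing.continuous_iff.2 <|
    (hg.comp continuous_subtype_val).congr fun x => (hr x).symm
  -- On `S`, the map `e ∘ r` is a retraction onto the range of `e`.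
  convert hS.isClosedMap _ (isClosed_eq (he.comp hr_cont) continuous_subtype_val) using 1
  ext x
  constructor
  · rintro ⟨a, rfl⟩
    exact ⟨⟨e a, a, rfl⟩, congrArg e (hge.injective (hr _)), rfl⟩
  · rintro ⟨x, hx, rfl⟩
    exact ⟨r x, hx⟩

end WeakHausdorffSpace

/-- The open cone on `P`: an apex, and a copy of `P` at each height `t > 0`. -/
inductive OpenCone (P : Type u) : Type u
  | apex : OpenCone P
  | point (p : P × Set.Ioi (0 : ℝ)) : OpenCone P

namespace OpenCone

section Set

variable {P : Type u}

/-- The height of a point of the cone, the apex being at height `0`. -/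
def height : OpenCone P → ℝ
  | apex => 0
  | point p => p.2

@[simp] theorem height_apex : height (apex : OpenCone P) = 0 := rfl

@[simp] theorem height_point (p : P × Set.Ioi (0 : ℝ)) : height (point p) = p.2 := rfl

theorem height_nonneg : ∀ q : OpenCone P, 0 ≤ height q
  | apex => le_rfl
  | point p => p.2.2.le

theorem height_eq_zero : ∀ {q : OpenCone P}, height q = 0 ↔ q = apex
  | apex => by simp
  | point p => by simpa using p.2.2.ne'

/-- The point over `x` at height `t`, by convention the apex if `t ≤ 0`. -/
noncomputable def atHeight (x : P) (t : ℝ) : OpenCone P :=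
  if h : 0 < t then point (x, ⟨t, h⟩) else apex

theorem atHeight_of_pos (x : P) {t : ℝ} (h : 0 < t) : atHeight x t = point (x, ⟨t, h⟩) := dif_pos h

theorem atHeight_of_nonpos (x : P) {t : ℝ} (h : t ≤ 0) : atHeight x t = apex := dif_neg h.not_gt

theorem height_atHeight (x : P) (t : ℝ) : height (atHeight x t) = max t 0 := by
  rcases lt_or_ge 0 t with h | h
  · rw [atHeight_of_pos x h, height_point, max_eq_left h.le]
  · rw [atHeight_of_nonpos x h, height_apex, max_eq_right h]

/-- Multiplication of heights by a positive scalar. -/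
def scale (s : Set.Ioi (0 : ℝ)) : OpenCone P → OpenCone P
  | apex => apex
  | point p => point (p.1, ⟨s * p.2, mul_pos (Set.mem_Ioi.1 s.2) p.2.2⟩)

theorem height_scale (s : Set.Ioi (0 : ℝ)) : ∀ q : OpenCone P, height (scale s q) = s * height q
  | apex => (mul_zero _).symm
  | point _ => rfl

theorem scale_of_eq_one {s : Set.Ioi (0 : ℝ)} (hs : (s : ℝ) = 1) :
    ∀ q : OpenCone P, scale s q = q
  | apex => rfl
  | point p => by simp only [scale, hs, one_mul]

end Set

section Topology

variable {P : Type u} [TopologicalSpace P]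

/-- The cone topology for which the sets of points of height less than `ε` form a basis of
neighbourhoods of the apex; it is coarser than the quotient topology. -/
instance : TopologicalSpace (OpenCone P) where
  IsOpen U := IsOpen (point ⁻¹' U) ∧ (apex ∈ U → ∃ ε > 0, ∀ q, height q < ε → q ∈ U)
  isOpen_univ := ⟨isOpen_univ, fun _ => ⟨1, one_pos, fun _ _ => trivial⟩⟩
  isOpen_inter U V hU hV := by
    refine ⟨hU.1.inter hV.1, fun h => ?_⟩
    obtain ⟨ε, hε, hεU⟩ := hU.2 h.1
    obtain ⟨δ, hδ, hδV⟩ := hV.2 h.2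
    exact ⟨min ε δ, lt_min hε hδ, fun q hq =>
      ⟨hεU q (lt_min_iff.1 hq).1, hδV q (lt_min_iff.1 hq).2⟩⟩
  isOpen_sUnion S hS := by
    refine ⟨?_, ?_⟩
    · rw [Set.preimage_sUnion]
      exact isOpen_biUnion fun U hU => (hS U hU).1
    · rintro ⟨U, hU, h⟩
      obtain ⟨ε, hε, hεU⟩ := (hS U hU).2 h
      exact ⟨ε, hε, fun q hq => ⟨U, hU, hεU q hq⟩⟩

theorem isOpen_iff {U : Set (OpenCone P)} :
    IsOpen U ↔ IsOpen (point ⁻¹' U) ∧ (apex ∈ U → ∃ ε > 0, ∀ q, height q < ε → q ∈ U) := Iff.rfl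

theorem isOpenEmbedding_point : IsOpenEmbedding (point (P := P)) := by
  have h_inj : Function.Injective (point (P := P)) := fun _ _ => point.inj
  refine .of_continuous_injective_isOpenMap (continuous_def.2 fun U hU => hU.1) h_inj
    fun U hU => isOpen_iff.2 ⟨by rwa [Set.preimage_image_eq _ h_inj], ?_⟩
  rintro ⟨_, _, h⟩
  cases h

theorem exists_continuous_lift {Z : Type*} [TopologicalSpace Z] {f : Z → OpenCone P}
    (hf : Continuous f) (h_pos : ∀ z, 0 < height (f z)) :
    ∃ g : Z → P × Set.Ioi (0 : ℝ), Continuous g ∧ point ∘ g = f := by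
  have h_point (z : Z) : ∃ p, point p = f z := by
    match f z, h_pos z with
    | apex, h => exact absurd h (lt_irrefl 0)
    | point p, _ => exact ⟨p, rfl⟩
  choose g hg using h_point
  obtain rfl : point ∘ g = f := funext hg
  exact ⟨g, isOpenEmbedding_point.isInducing.continuous_iff.2 hf, rfl⟩

theorem continuous_height : Continuous (height : OpenCone P → ℝ) := by
  refine continuous_def.2 fun s hs => isOpen_iff.2 ⟨?_, fun h => ?_⟩
  · exact hs.preimage (continuous_subtype_val.comp continuous_snd)
  · obtain ⟨ε, hε, hεs⟩ := Metric.isOpen_iff.1 hs 0 h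
    refine ⟨ε, hε, fun q hq => hεs ?_⟩
    rwa [Metric.mem_ball, Real.dist_0_eq_abs, abs_of_nonneg (height_nonneg q)]

theorem tendsto_nhds_apex {Z : Type*} {l : Filter Z} {g : Z → OpenCone P} :
    Filter.Tendsto g l (𝓝 apex) ↔ Filter.Tendsto (fun z => height (g z)) l (𝓝 0) := by
  refine ⟨fun h => (continuous_height.tendsto apex).comp h,
    fun h => tendsto_nhds.2 fun U hU ha => ?_⟩
  obtain ⟨ε, hε, hεU⟩ := (isOpen_iff.1 hU).2 ha
  filter_upwards [h.eventually_lt_const hε] with z hz using hεU _ hz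

theorem isClosedEmbedding_point (t : Set.Ioi (0 : ℝ)) :
    IsClosedEmbedding fun x : P => point (x, t) := by
  refine ⟨isOpenEmbedding_point.isEmbedding.comp (isEmbedding_prodMkLeft t), ?_⟩
  convert isClosed_singleton.preimage (continuous_height (P := P)) (t := {(t : ℝ)}) using 1
  ext (_ | ⟨x, s⟩)
  · simpa using t.2.ne
  · simp [eq_comm, SetCoe.ext_iff]

theorem continuous_atHeight : Continuous fun p : P × ℝ => atHeight p.1 p.2 := by
  refine continuous_iff_continuousAt.2 fun p => ?_
  rcases lt_or_ge 0 p.2 with hp | hp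
  · have h_open : IsOpen {p : P × ℝ | 0 < p.2} := isOpen_lt continuous_const continuous_snd
    refine ContinuousOn.continuousAt ?_ (h_open.mem_nhds hp)
    rw [continuousOn_iff_continuous_domRestrict]
    have h_lift : Continuous fun p : {p : P × ℝ | 0 < p.2} =>
        ((p.1.1, ⟨p.1.2, p.2⟩) : P × Set.Ioi (0 : ℝ)) := by fun_prop
    have h_point : Continuous fun p : {p : P × ℝ | 0 < p.2} => point (p.1.1, ⟨p.1.2, p.2⟩) :=
      isOpenEmbedding_point.continuous.comp h_lift
    exact h_point.congr fun p => (atHeight_of_pos _ p.2).symm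
  · rw [ContinuousAt, atHeight_of_nonpos _ hp, tendsto_nhds_apex]
    simp only [height_atHeight]
    exact Continuous.tendsto' (by fun_prop) p 0 (max_eq_right hp)

theorem continuous_scale :
    Continuous fun p : Set.Ioi (0 : ℝ) × OpenCone P => scale p.1 p.2 := by
  refine continuous_iff_continuousAt.2 ?_
  rintro ⟨s, _ | p⟩
  · refine tendsto_nhds_apex.2 ?_
    simp only [height_scale]
    have h_height : Continuous fun p : Set.Ioi (0 : ℝ) × OpenCone P => (p.1 : ℝ) * height p.2 :=
      (continuous_subtype_val.comp continuous_fst).mul (continuous_height.comp continuous_snd)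
    exact h_height.tendsto' _ _ (mul_zero _)
  · refine (IsOpenEmbedding.id.prodMap isOpenEmbedding_point).continuousAt_iff (x := (s, p)).1
      (Continuous.continuousAt ?_)
    have h_lift : Continuous fun p : Set.Ioi (0 : ℝ) × P × Set.Ioi (0 : ℝ) =>
        ((p.2.1, ⟨p.1 * p.2.2, mul_pos (Set.mem_Ioi.1 p.1.2) p.2.2.2⟩) : P × Set.Ioi (0 : ℝ)) := by
      fun_prop
    exact isOpenEmbedding_point.continuous.comp h_lift

section WeakHausdorff

variable [WeakHausdorffSpace P] {K : Type u} [TopologicalSpace K] [CompactSpace K] [T2Space K]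
  {f : K → OpenCone P}

theorem isClosed_preimage_point_range_of_height_pos (hf : Continuous f)
    (h_pos : ∀ k, 0 < height (f k)) : IsClosed (point ⁻¹' Set.range f) := by
  obtain ⟨g, hg_cont, hg⟩ := exists_continuous_lift hf h_pos
  convert WeakHausdorffSpace.isClosed_range_prodMk hg_cont.fst hg_cont.snd using 1
  rw [← hg, Set.range_comp, Set.preimage_image_eq _ isOpenEmbedding_point.injective]

theorem isClosed_preimage_point_range (hf : Continuous f) : IsClosed (point ⁻¹' Set.range f) := by
  -- Near `p`, only the compact set of the `k` with `height (f k)` at least `p.2 / 2` matters.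
  refine isClosed_iff_frequently.2 fun p hp => ?_
  have h_half : (p.2 : ℝ) / 2 < p.2 := half_lt_self p.2.2
  let L : Set K := {k | (p.2 : ℝ) / 2 ≤ height (f k)}
  have hL : IsClosed L := isClosed_le continuous_const (continuous_height.comp hf)
  have : CompactSpace L := isCompact_iff_compactSpace.1 hL.isCompact
  have hfL : Continuous fun k : L => f k := hf.comp continuous_subtype_val
  have h_closed := isClosed_preimage_point_range_of_height_pos hfL fun k =>
    (half_pos p.2.2).trans_le k.2
  have h_near : ∀ᶠ q : P × Set.Ioi (0 : ℝ) in 𝓝 p, (p.2 : ℝ) / 2 < q.2 :=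
    (continuous_subtype_val.comp continuous_snd).continuousAt.eventually_const_lt h_half
  obtain ⟨k, hk⟩ : p ∈ point ⁻¹' Set.range fun k : L => f k := by
    refine isClosed_iff_frequently.1 h_closed p ((hp.and_eventually h_near).mono ?_)
    rintro q ⟨⟨k, hk⟩, hq⟩
    have hkL : (p.2 : ℝ) / 2 ≤ height (f k) := by rw [hk]; exact hq.le
    exact ⟨⟨k, hkL⟩, hk⟩
  exact ⟨k, hk⟩

instance : WeakHausdorffSpace (OpenCone P) where
  isClosed_range K _ _ _ f hf := by
    refine isOpen_compl_iff.1 (isOpen_iff.2 ⟨?_, fun ha => ?_⟩)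
    · exact (isClosed_preimage_point_range hf).isOpen_compl
    · have h_heights : IsClosed (Set.range fun k => height (f k)) :=
        (isCompact_range (continuous_height.comp hf)).isClosed
      have h0 : (0 : ℝ) ∉ Set.range fun k => height (f k) := by
        rintro ⟨k, hk⟩
        exact ha ⟨k, height_eq_zero.1 hk⟩
      obtain ⟨ε, hε, hball⟩ := Metric.isOpen_iff.1 h_heights.isOpen_compl 0 h0
      refine ⟨ε, hε, ?_⟩
      rintro _ hk ⟨k, rfl⟩
      refine hball ?_ ⟨k, rfl⟩
      rwa [Metric.mem_ball, Real.dist_0_eq_abs, abs_of_nonneg (height_nonneg _)]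

end WeakHausdorff

end Topology

section RadialExtension

open Metric

variable {P : Type u} {E : Type*} [NormedAddCommGroup E] [NormedSpace ℝ E]
  {f : sphere (0 : E) 1 → OpenCone P}

open Classical in
/-- The extension `z ↦ ‖z‖ • f (z / ‖z‖)` to a normed space of a map from its unit sphere to a
cone. -/
noncomputable def radialExtension (f : sphere (0 : E) 1 → OpenCone P) (z : E) : OpenCone P :=
  if hz : z ≠ 0 then
    scale (homeomorphUnitSphereProd E ⟨z, hz⟩).2 (f (homeomorphUnitSphereProd E ⟨z, hz⟩).1)
  else apex

theorem radialExtension_zero : radialExtension f 0 = apex := dif_neg (not_not.2 rfl)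

theorem radialExtension_of_ne_zero {z : E} (hz : z ≠ 0) :
    radialExtension f z =
      scale (homeomorphUnitSphereProd E ⟨z, hz⟩).2 (f (homeomorphUnitSphereProd E ⟨z, hz⟩).1) :=
  dif_pos hz

theorem radialExtension_coe_sphere (z : sphere (0 : E) 1) : radialExtension f z = f z := by
  have h_norm : ‖(z : E)‖ = 1 := norm_eq_of_mem_sphere z
  rw [radialExtension_of_ne_zero (ne_zero_of_mem_unit_sphere z),
    scale_of_eq_one ((homeomorphUnitSphereProd_apply_snd_coe E _).trans h_norm)]
  congr 1
  ext1
  simp [h_norm]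

theorem height_radialExtension_le {M : ℝ} (hM : ∀ z, height (f z) ≤ M) (z : E) :
    height (radialExtension f z) ≤ ‖z‖ * M := by
  rcases eq_or_ne z 0 with rfl | hz
  · simp [radialExtension_zero]
  · rw [radialExtension_of_ne_zero hz, height_scale, homeomorphUnitSphereProd_apply_snd_coe]
    exact mul_le_mul_of_nonneg_left (hM _) (norm_nonneg z)

theorem continuous_radialExtension [TopologicalSpace P] [ProperSpace E] (hf : Continuous f) :
    Continuous (radialExtension f) := by
  refine continuous_iff_continuousAt.2 fun z => ?_
  rcases eq_or_ne z 0 with rfl | hz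
  · obtain ⟨M, hM⟩ := (isCompact_range (continuous_height.comp hf)).bddAbove
    have h_lim : Filter.Tendsto (fun w : E => ‖w‖ * M) (𝓝 0) (𝓝 0) :=
      Continuous.tendsto' (by fun_prop) 0 0 (by simp)
    rw [ContinuousAt, radialExtension_zero, tendsto_nhds_apex]
    exact squeeze_zero (fun _ => height_nonneg _)
      (height_radialExtension_le fun z => hM ⟨z, rfl⟩) h_lim
  · refine ContinuousOn.continuousAt ?_ (isOpen_ne.mem_nhds hz)
    rw [continuousOn_iff_continuous_domRestrict]
    have h_polar : Continuous fun w : ({0}ᶜ : Set E) => homeomorphUnitSphereProd E w :=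
      (homeomorphUnitSphereProd E).continuous
    exact (continuous_scale.comp (h_polar.snd.prodMk (hf.comp h_polar.fst))).congr fun w =>
      (radialExtension_of_ne_zero w.2).symm

end RadialExtension

end OpenCone

namespace PathFlow

open OpenCone

section ConeComposition

variable {A : PathFlow.{u}}

open Classical in
/-- The composition law of the cone of a flow: the height of a composite is the minimum of the
heights, and the composite of two paths which are not composable is the apex. -/
noncomputable def coneComp : OpenCone A.Path → OpenCone A.Path → OpenCone A.Path
  | point a, point b =>
    if h : A.tgt a.1 = A.src b.1 then point (A.comp a.1 b.1 h, min a.2 b.2) else apex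
  | apex, _ => apex
  | point _, apex => apex

@[simp] theorem coneComp_apex_left (q : OpenCone A.Path) : coneComp apex q = apex := rfl

@[simp] theorem coneComp_apex_right : ∀ q : OpenCone A.Path, coneComp q apex = apex
  | apex => rfl
  | point _ => rfl

theorem coneComp_point {a b : A.Path × Set.Ioi (0 : ℝ)} (h : A.tgt a.1 = A.src b.1) :
    coneComp (point a) (point b) = point (A.comp a.1 b.1 h, min a.2 b.2) := dif_pos h

theorem coneComp_point_of_ne {a b : A.Path × Set.Ioi (0 : ℝ)} (h : A.tgt a.1 ≠ A.src b.1) :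
    coneComp (point a) (point b) = apex := dif_neg h

theorem height_coneComp_le : ∀ p q : OpenCone A.Path,
    height (coneComp p q) ≤ min (height p) (height q)
  | apex, q => le_min le_rfl (height_nonneg q)
  | point a, apex => le_min (height_nonneg (point a)) le_rfl
  | point a, point b => by
    by_cases h : A.tgt a.1 = A.src b.1
    · rw [coneComp_point h]
      exact le_min (min_le_left a.2 b.2) (min_le_right a.2 b.2)
    · rw [coneComp_point_of_ne h]
      exact le_min (height_nonneg _) (height_nonneg _)

theorem coneComp_assoc : ∀ p q r : OpenCone A.Path,
    coneComp (coneComp p q) r = coneComp p (coneComp q r)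
  | apex, _, _ => rfl
  | point _, apex, _ => rfl
  | point _, point _, apex => by simp only [coneComp_apex_right]
  | point a, point b, point c => by
    by_cases hab : A.tgt a.1 = A.src b.1 <;> by_cases hbc : A.tgt b.1 = A.src c.1
    · rw [coneComp_point hab, coneComp_point hbc, coneComp_point ((A.tgt_comp _ _ hab).trans hbc),
        coneComp_point (hab.trans (A.src_comp _ _ hbc).symm), A.comp_assoc, min_assoc]
    · rw [coneComp_point hab, coneComp_point_of_ne hbc, coneComp_apex_right,
        coneComp_point_of_ne (by rwa [A.tgt_comp])]
    · rw [coneComp_point_of_ne hab, coneComp_point hbc, coneComp_apex_left,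
        coneComp_point_of_ne (by rwa [A.src_comp])]
    · rw [coneComp_point_of_ne hab, coneComp_point_of_ne hbc, coneComp_apex_left,
        coneComp_apex_right]

theorem isClopen_composable : IsClopen {c : A.Path × A.Path | A.tgt c.1 = A.src c.2} := by
  let _ : TopologicalSpace A.State := ⊥
  have : DiscreteTopology A.State := ⟨rfl⟩
  exact (isClopen_discrete {e : A.State × A.State | e.1 = e.2}).preimage
    (A.continuous_tgt.prodMap A.continuous_src)

variable {K : Type u} [TopologicalSpace K]

theorem continuous_comp_apply [CompactlyGeneratedSpace K] {x y : K → A.Path} (hx : Continuous x)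
    (hy : Continuous y) (h : ∀ k, A.tgt (x k) = A.src (y k)) :
    Continuous fun k => A.comp (x k) (y k) (h k) := by
  have h_pair : Continuous fun k =>
      (⟨(x k, y k), h k⟩ : {c : A.Path × A.Path // A.tgt c.1 = A.src c.2}) := by fun_prop
  exact Continuous.comp (Y := KIfication {c : A.Path × A.Path // A.tgt c.1 = A.src c.2})
    A.continuous_comp (KIfication.continuous_of_comp h_pair)

theorem continuous_coneComp_point [CompactlyGeneratedSpace K]
    {a b : K → A.Path × Set.Ioi (0 : ℝ)} (ha : Continuous a) (hb : Continuous b) :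
    Continuous fun k => coneComp (point (a k)) (point (b k)) := by
  let C : Set K := {k | A.tgt (a k).1 = A.src (b k).1}
  have hC : IsClopen C := isClopen_composable.preimage (ha.fst.prodMk hb.fst)
  have := compactlyGeneratedSpace_of_isClosedEmbedding hC.isClosed.isClosedEmbedding_subtypeVal
  have haC : Continuous fun k : C => a k := ha.comp continuous_subtype_val
  have hbC : Continuous fun k : C => b k := hb.comp continuous_subtype_val
  have h_comp : ContinuousOn (fun k => coneComp (point (a k)) (point (b k))) C := by
    rw [continuousOn_iff_continuous_domRestrict]
    have h_lift := (continuous_comp_apply haC.fst hbC.fst Subtype.property).prodMk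
      (haC.snd.min hbC.snd)
    exact (isOpenEmbedding_point.continuous.comp h_lift).congr fun k => (coneComp_point k.2).symm
  have h_apex : ContinuousOn (fun k => coneComp (point (a k)) (point (b k))) Cᶜ :=
    continuousOn_const.congr fun k hk => coneComp_point_of_ne hk
  rw [← continuousOn_univ, ← Set.union_compl_self C]
  exact h_comp.union_of_isOpen h_apex hC.isOpen hC.compl.isOpen

theorem continuous_coneComp [LocallyCompactSpace K] [T2Space K] {p q : K → OpenCone A.Path}
    (hp : Continuous p) (hq : Continuous q) : Continuous fun k => coneComp (p k) (q k) := by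
  refine continuous_iff_continuousAt.2 fun k => ?_
  have hp_height : Continuous fun k => height (p k) := continuous_height.comp hp
  have hq_height : Continuous fun k => height (q k) := continuous_height.comp hq
  let V : Set K := {k | 0 < min (height (p k)) (height (q k))}
  have hV : IsOpen V := isOpen_lt continuous_const (hp_height.min hq_height)
  by_cases hk : k ∈ V
  · refine ContinuousOn.continuousAt ?_ (hV.mem_nhds hk)
    have : LocallyCompactSpace V := hV.locallyCompactSpace
    obtain ⟨a, ha_cont, ha⟩ := exists_continuous_lift
      (hp.comp continuous_subtype_val) fun k : V => (lt_min_iff.1 k.2).1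
    obtain ⟨b, hb_cont, hb⟩ := exists_continuous_lift
      (hq.comp continuous_subtype_val) fun k : V => (lt_min_iff.1 k.2).2
    rw [continuousOn_iff_continuous_domRestrict]
    exact (continuous_coneComp_point ha_cont hb_cont).congr fun k =>
      congrArg₂ coneComp (congrFun ha k) (congrFun hb k)
  · have h_min : min (height (p k)) (height (q k)) = 0 :=
      (not_lt.1 hk).antisymm (le_min (height_nonneg _) (height_nonneg _))
    have h_apex : coneComp (p k) (q k) = apex := height_eq_zero.1 <|
      ((height_coneComp_le _ _).trans_eq h_min).antisymm (height_nonneg _)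
    rw [ContinuousAt, h_apex, tendsto_nhds_apex]
    exact squeeze_zero (fun _ => height_nonneg _) (fun _ => height_coneComp_le _ _)
      ((hp_height.min hq_height).tendsto' k 0 h_min)

end ConeComposition

section Cone

variable {A X : PathFlow.{u}}

/-- The cone of a flow: a flow with a single state, whose paths are the points of the open cone on
the path space. -/
noncomputable def cone (A : PathFlow.{u}) : PathFlow.{u} where
  State := PUnit
  Path := KIfication (OpenCone A.Path)
  src _ := PUnit.unit
  tgt _ := PUnit.unit
  continuous_src := @continuous_const _ _ _ ⊥ _
  continuous_tgt := @continuous_const _ _ _ ⊥ _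
  comp p q _ := KIfication.of (coneComp (KIfication.of.symm p) (KIfication.of.symm q))
  continuous_comp := KIfication.continuous_of_forall_compact fun _ _ _ _ g hg => by
    have h_pair := continuous_subtype_val.comp hg
    exact KIfication.continuous_of_comp <| continuous_coneComp
      (KIfication.continuous_of_symm.comp h_pair.fst)
      (KIfication.continuous_of_symm.comp h_pair.snd)
  src_comp _ _ _ := rfl
  tgt_comp _ _ _ := rfl
  comp_assoc _ _ _ _ _ := congrArg KIfication.of (coneComp_assoc _ _ _)

/-- The constant morphism to a cone, sending every path to the apex. -/
def toApex (X A : PathFlow.{u}) : X ⟶ A.cone :=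
  Hom.mk (fun _ => PUnit.unit) (fun _ => KIfication.of apex) continuous_const
    (fun _ => rfl) (fun _ => rfl) (fun _ _ _ => rfl)

theorem continuous_of_atHeight :
    Continuous fun p : unitInterval × A.Path => KIfication.of (atHeight p.2 p.1) := by
  have := compactlyGeneratedSpace_prod (I := unitInterval) (X := A.Path)
  exact KIfication.continuous_of_comp <| continuous_atHeight.comp <|
    continuous_snd.prodMk (continuous_subtype_val.comp continuous_fst)

theorem atHeight_comp {x y : A.Path} (h : A.tgt x = A.src y) (t : ℝ) :
    atHeight (A.comp x y h) t = coneComp (atHeight x t) (atHeight y t) := by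
  rcases lt_or_ge 0 t with ht | ht
  · rw [atHeight_of_pos _ ht, atHeight_of_pos _ ht, atHeight_of_pos _ ht,
      coneComp_point (a := (x, _)) (b := (y, _)) h, min_self]
  · simp only [atHeight_of_nonpos _ ht, coneComp_apex_left]

/-- The inclusion of a flow in its cone at height `t`. -/
noncomputable def toCone (A : PathFlow.{u}) (t : unitInterval) : A ⟶ A.cone :=
  Hom.mk (fun _ => PUnit.unit) (fun x => KIfication.of (atHeight x t))
    (continuous_of_atHeight.comp (.prodMk_right t))
    (fun _ => rfl) (fun _ => rfl) (fun _ _ h => congrArg KIfication.of (atHeight_comp h t))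

theorem toCone_zero : A.toCone 0 = toApex A A :=
  Hom.ext rfl (funext fun x => congrArg KIfication.of (atHeight_of_nonpos x le_rfl))

/-- The S-homotopy from the constant morphism to the inclusion of a flow in its cone at
height `1`. -/
noncomputable def toConeHomotopy (A : PathFlow.{u}) : SHomotopy A A.cone where
  toFun := A.toCone
  continuous_onState _ := @continuous_const _ _ _ ⊥ _
  continuous_onPath := continuous_of_atHeight

theorem closedInclusions_toCone_one : closedInclusions (A.toCone 1) := by
  have h_onPath : (A.toCone 1).onPath =
      fun x => KIfication.of (point (x, ⟨1, Set.mem_Ioi.2 one_pos⟩)) :=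
    funext fun x => congrArg KIfication.of (atHeight_of_pos x one_pos)
  rw [closedInclusions, h_onPath]
  exact KIfication.isClosedEmbedding_of_comp (isClosedEmbedding_point _)

theorem closedInclusions_of_comp {Y : PathFlow.{u}} (i : A ⟶ X) (g : X ⟶ Y)
    (h : closedInclusions (i ≫ g)) : closedInclusions i :=
  WeakHausdorffSpace.isClosedEmbedding_of_isClosedEmbedding_comp i.continuous_onPath
    g.continuous_onPath h

theorem closedInclusions_of_hasSHEPFor_cone (i : A ⟶ X) (hi : HasSHEPFor i A.cone) :
    closedInclusions i := by
  obtain ⟨H, -, hH⟩ := hi (toApex X A) A.toConeHomotopy toCone_zero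
  exact closedInclusions_of_comp i (H.toFun 1) ((hH 1).symm ▸ closedInclusions_toCone_one)

end Cone

section Cofibrations

variable {A X : PathFlow.{u}}

/-- The terminal flow: one state and one path. -/
def terminal : PathFlow.{u} where
  State := PUnit
  Path := PUnit
  src := id
  tgt := id
  continuous_src := continuous_of_discreteTopology
  continuous_tgt := continuous_of_discreteTopology
  comp _ _ _ := PUnit.unit
  continuous_comp := @continuous_const _ _ (_) _ _
  src_comp _ _ _ := rfl
  tgt_comp _ _ _ := rfl
  comp_assoc _ _ _ _ _ := rfl

instance uniqueHomTerminal (X : PathFlow.{u}) : Unique (X ⟶ terminal) where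
  default := Hom.mk (fun _ => PUnit.unit) (fun _ => PUnit.unit) continuous_const
    (fun _ => rfl) (fun _ => rfl) (fun _ _ _ => rfl)
  uniq _ := Hom.ext rfl rfl

/-- The morphism from a globe to a cone given by a family of points of the cone. -/
def globToCone {Z : Type u} [TopologicalSpace Z] [CompactlyGeneratedSpace Z] [WeakHausdorffSpace Z]
    (f : C(Z, OpenCone A.Path)) : glob Z ⟶ A.cone :=
  Hom.mk (fun _ => PUnit.unit) (fun z => KIfication.of (f z))
    (KIfication.continuous_of_comp f.continuous : Continuous fun z : Z => KIfication.of (f z))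
    (fun _ => rfl) (fun _ => rfl)
    (fun _ _ h => absurd (congrArg ULift.down h) Bool.noConfusion)

theorem exists_globSphereToDisk_comp_eq (n : ℕ) (f : glob (TopCat.diskBoundary.{u} n) ⟶ A.cone) :
    ∃ g : glob (TopCat.disk.{u} n) ⟶ A.cone, globSphereToDisk n ≫ g = f := by
  let onSphere : Metric.sphere (0 : EuclideanSpace ℝ (Fin n)) 1 → OpenCone A.Path :=
    fun z => KIfication.of.symm (f.onPath (ULift.up z))
  have h_sphere : Continuous onSphere := KIfication.continuous_of_symm.comp <|
    f.continuous_onPath.comp continuous_uliftUp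
  let onDisk : C(TopCat.disk.{u} n, OpenCone A.Path) :=
    ⟨fun z => radialExtension onSphere z.down.1, (continuous_radialExtension h_sphere).comp <|
      continuous_subtype_val.comp continuous_uliftDown⟩
  exact ⟨globToCone onDisk, Hom.ext rfl <| funext fun z =>
    congrArg KIfication.of (radialExtension_coe_sphere z.down)⟩

theorem rlp_cone_terminal : generatingCofibrations.rlp (default : A.cone ⟶ terminal) := by
  intro X Y i hi
  suffices h_extend : ∀ f : X ⟶ A.cone, ∃ g : Y ⟶ A.cone, i ≫ g = f from
    ⟨fun {f _} _ => ⟨⟨_, (h_extend f).choose_spec, Subsingleton.elim _ _⟩⟩⟩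
  cases hi with
  | globe n => exact exists_globSphereToDisk_comp_eq n
  | R => exact fun f => ⟨toApex _ _, Hom.ext rfl (funext fun x => x.elim)⟩
  | C => exact fun f => ⟨toApex _ _, Hom.ext rfl (funext fun x => x.elim)⟩

theorem closedInclusions_of_cofibrations (i : A ⟶ X) (hi : cofibrations i) :
    closedInclusions i := by
  have := hi _ (rlp_cone_terminal (A := A))
  have sq : CommSq (A.toCone 1) i (default : A.cone ⟶ terminal) default :=
    ⟨Subsingleton.elim _ _⟩
  exact closedInclusions_of_comp i sq.lift (sq.fac_left.symm ▸ closedInclusions_toCone_one)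

end Cofibrations

theorem mainTheorem8_general {A X : PathFlow.{u}} (i : A ⟶ X) :
    (HasSHEPFor i A.cone → closedInclusions i) ∧ (cofibrations i → closedInclusions i) :=
  ⟨closedInclusions_of_hasSHEPFor_cone i, closedInclusions_of_cofibrations i⟩

end PathFlow

theorem mainTheorem8 :
    (∀ {A X : PathFlow.{u}} (i : A ⟶ X), PathFlow.HasSHEP i → PathFlow.closedInclusions i) ∧
      (∀ {A X : PathFlow.{u}} (i : A ⟶ X), PathFlow.cofibrations i → PathFlow.closedInclusions i) := by
  exact ⟨fun i hi => (PathFlow.mainTheorem8_general i).1 (hi.2 _),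
    fun i => (PathFlow.mainTheorem8_general i).2⟩
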